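/- Let $n \ge 1$, let $r > 1$ be a real number, and let $\mathcal{C}_1, \dots, \mathcal{C}_n$ be circles of radius $r$ in the Euclidean plane whose centres are $n$ distinct points of a fixed circle of radius $1$. Then the circles are in general arrangement, that is: any two of them intersect, no two of them are tangent, none of them lies entirely within or entirely outside another one, and no three of them share a common point. Moreover they divide the plane into exactly $n^2 - n + 2$ regions, that is, the complement of $\mathcal{C}_1 \cup \dots \cup \mathcal{C}_n$ in the plane has exactly $n^2 - n + 2$ connected components. -/

import Mathlib

/-- The Euclidean plane. -/
abbrev Plane : Type := EuclideanSpace ℝ (Fin 2)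

/-- A family of circles in the plane is in general arrangement when any two of them intersect
(no two of them are tangent, and none of them lies entirely within or entirely outside another
one) and no three of them share a common point. -/
structure InGeneralArrangement {ι : Type*} (C : ι → EuclideanGeometry.Sphere Plane) : Prop where
  intersect : ∀ i j, i ≠ j → ((C i : Set Plane) ∩ (C j : Set Plane)).Nonempty
  not_tangent : ∀ i j, i ≠ j → ¬ (C i).IsExtTangent (C j) ∧ ¬ (C i).IsIntTangent (C j)
  not_within : ∀ i j, i ≠ j →
    ¬ (C i : Set Plane) ⊆ Metric.closedBall (C j).center (C j).radius
  not_outside : ∀ i j, i ≠ j →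
    ¬ (C i : Set Plane) ⊆ (Metric.ball (C j).center (C j).radius)ᶜ
  no_triple : ∀ i j k, i ≠ j → i ≠ k → j ≠ k →
    (C i : Set Plane) ∩ (C j : Set Plane) ∩ (C k : Set Plane) = ∅

/-- The regions into which a family of circles divides the plane: the connected components of
the complement of the union of the circles. -/
def planeRegions {ι : Type*} (C : ι → EuclideanGeometry.Sphere Plane) : Set (Set Plane) :=
  {R | ∃ x ∈ (⋃ i, (C i : Set Plane))ᶜ, R = connectedComponentIn (⋃ i, (C i : Set Plane))ᶜ x}

/-!
Write `c i` for the centres and `O` for the centre of the unit circle carrying them. Since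
`‖c i - O‖ = 1`, the power of a point `p` with respect to the `i`-th circle is
`‖p - O‖² - 2⟪c i - O, p - O⟫ + 1 - r²`. Hence, after lifting `p` to the point
`(p - O, (‖p - O‖² + 1 - r²) / 2)` of a paraboloid in `Plane × ℝ`, the inside and the outside of
the `i`-th circle are the positive and the negative side of the plane through the origin cut out by
the linear functional `(v, z) ↦ ⟪c i - O, v⟫ - z` (`centreFunctional_paraboloidLift`).

Because `r > 1`, every ray from the origin meets the paraboloid exactly once, except for the
vertical ray `v = 0, z > 0`, which misses it. So the part of the plane with a given sign vector is
the continuous image, along rays, of a chamber of the central arrangement of these `n` planes, with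
the half-axis `v = 0, z ≥ 0` removed (`preimage_chamber_eq_image`). A chamber is convex, and only
the chamber with all signs negative (the outside of all the circles) meets that half-axis; what is
left of it is still connected, being the part of `{v ≠ 0} × ℝ` above the graph of a continuous
function. Therefore the regions of the plane correspond to the chambers (`planeRegions_eq_image`).

Distinct points of a circle, at most three of them, are affinely independent, so any three of the
functionals are linearly independent. The chambers of an arrangement in general position are
counted by deletion and restriction: adding a hyperplane `H` cuts in two exactly those chambers that
meet `H`, and these are the chambers of the arrangement restricted to `H`
(`ncard_signVectors_succ`). In dimension three this gives `n² - n + 2`.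
-/

open Filter Topology

/-! ### Chambers of central hyperplane arrangements -/

/-- The open chamber of the central hyperplane arrangement `ker (ℓ i)` on which each `ℓ i` has the
sign `σ i`; signs are encoded as the units `1` and `-1` of `ℤ`. The chamber may be empty. -/
def chamber {m : ℕ} {E : Type*} [AddCommGroup E] [Module ℝ E] (ℓ : Fin m → Module.Dual ℝ E)
    (σ : Fin m → ℤˣ) : Set E :=
  {x | ∀ i, 0 < σ i • ℓ i x}

/-- The sign vectors of the nonempty chambers of the arrangement. -/
def signVectors {m : ℕ} {E : Type*} [AddCommGroup E] [Module ℝ E]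
    (ℓ : Fin m → Module.Dual ℝ E) : Set (Fin m → ℤˣ) :=
  {σ | (chamber ℓ σ).Nonempty}

/-- The number of chambers of `m` hyperplanes through the origin in general position in dimension
`d`, given by its deletion-restriction recursion. In dimension `0` general position puts no
condition on the functionals: they vanish, and as soon as there is one there is no chamber. -/
def chamberCount : ℕ → ℕ → ℕ
  | _, 0 => 1
  | 0, _ + 1 => 0
  | d + 1, m + 1 => chamberCount (d + 1) m + chamberCount d m

section
variable {m : ℕ} {E : Type*} [AddCommGroup E] [Module ℝ E]

/-- Chambers are open along lines; this form needs no topology on the vector space. -/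
lemma eventually_add_smul_mem_chamber {ℓ : Fin m → Module.Dual ℝ E} {σ : Fin m → ℤˣ} {x : E}
    (hx : x ∈ chamber ℓ σ) (w : E) : ∀ᶠ t in 𝓝 (0 : ℝ), x + t • w ∈ chamber ℓ σ := by
  simp only [chamber, Set.mem_ofPred_eq, eventually_all]
  intro i
  have hc : Continuous fun t : ℝ => σ i • ℓ i (x + t • w) := by
    rcases Int.units_eq_one_or (σ i) with h | h <;> simp [h, Units.smul_def] <;> fun_prop
  have h0 : 0 < σ i • ℓ i (x + (0 : ℝ) • w) := by simpa using hx i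
  exact hc.continuousAt.eventually (lt_mem_nhds h0)

lemma convex_chamber (ℓ : Fin m → Module.Dual ℝ E) (σ : Fin m → ℤˣ) :
    Convex ℝ (chamber ℓ σ) := by
  have h : chamber ℓ σ = ⋂ i, {x | 0 < (σ i • ℓ i) x} := by
    ext x; simp [chamber]
  rw [h]
  exact convex_iInter fun i => convex_halfSpace_gt (σ i • ℓ i).isLinear 0

lemma mem_chamber_cons {ℓ : Fin (m + 1) → Module.Dual ℝ E} {τ : Fin m → ℤˣ} {e : ℤˣ} {x : E} :
    x ∈ chamber ℓ (Fin.cons e τ) ↔ 0 < e • ℓ 0 x ∧ x ∈ chamber (Fin.tail ℓ) τ := by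
  simp [chamber, Fin.forall_fin_succ, Fin.tail]

/-- Deletion and restriction: adding the hyperplane `ker (ℓ 0)` to the arrangement of the other
functionals creates as many new chambers as the arrangement restricted to this hyperplane has. -/
lemma ncard_signVectors_succ (ℓ : Fin (m + 1) → Module.Dual ℝ E) (h0 : ℓ 0 ≠ 0) :
    (signVectors ℓ).ncard = (signVectors (Fin.tail ℓ)).ncard +
      (signVectors fun i : Fin m => (ℓ i.succ).domRestrict (LinearMap.ker (ℓ 0))).ncard := by
  obtain ⟨w, hw⟩ : ∃ w, ℓ 0 w = 1 := LinearMap.surjective h0 1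
  -- the sign vectors of the other functionals that are compatible with the sign `e` of `ℓ 0`
  let A : ℤˣ → Set (Fin m → ℤˣ) := fun e => {τ | Fin.cons e τ ∈ signVectors ℓ}
  have hsplit : signVectors ℓ = Fin.cons (α := fun _ => ℤˣ) 1 '' A 1 ∪
      Fin.cons (α := fun _ => ℤˣ) (-1) '' A (-1) := by
    ext σ
    constructor
    · intro hσ
      rw [← Fin.cons_self_tail σ] at hσ ⊢
      rcases Int.units_eq_one_or (σ 0) with h | h <;> rw [h] at hσ ⊢
      · exact Or.inl ⟨_, hσ, rfl⟩
      · exact Or.inr ⟨_, hσ, rfl⟩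
    · rintro (⟨τ, hτ, rfl⟩ | ⟨τ, hτ, rfl⟩) <;> exact hτ
  have hdisj : Disjoint (Fin.cons (α := fun _ => ℤˣ) 1 '' A 1)
      (Fin.cons (α := fun _ => ℤˣ) (-1) '' A (-1)) := by
    rw [Set.disjoint_left]
    rintro _ ⟨τ, -, rfl⟩ ⟨τ', -, h⟩
    have := congrFun h 0
    simp at this

  -- a chamber of the remaining functionals that meets the hyperplane extends with both signs
  have hpush : ∀ x : E, ∀ τ : Fin m → ℤˣ, ℓ 0 x = 0 → x ∈ chamber (Fin.tail ℓ) τ →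
      ∀ e, τ ∈ A e := by
    intro x τ hx hxτ e
    have hE := (eventually_add_smul_mem_chamber hxτ (e • w)).filter_mono
      (nhdsWithin_le_nhds (s := Set.Ioi 0))
    obtain ⟨t, ht, ht0⟩ := (hE.and self_mem_nhdsWithin).exists
    refine ⟨x + t • e • w, mem_chamber_cons.2 ⟨?_, ht⟩⟩
    have ht0 : 0 < t := ht0
    rcases Int.units_eq_one_or e with h | h <;> simp [h, hx, hw, ht0, Units.smul_def]
  have hunion : A 1 ∪ A (-1) = signVectors (Fin.tail ℓ) := by
    ext τ
    constructor
    · rintro (⟨x, hx⟩ | ⟨x, hx⟩) <;> exact ⟨x, (mem_chamber_cons.1 hx).2⟩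
    · rintro ⟨x, hx⟩
      rcases lt_trichotomy (ℓ 0 x) 0 with h | h | h
      · exact Or.inr ⟨x, mem_chamber_cons.2 ⟨by simpa [Units.smul_def] using h, hx⟩⟩
      · exact Or.inl (hpush x τ h hx 1)
      · exact Or.inl ⟨x, mem_chamber_cons.2 ⟨by simpa using h, hx⟩⟩
  have hinter : A 1 ∩ A (-1) =
      signVectors fun i : Fin m => (ℓ i.succ).domRestrict (LinearMap.ker (ℓ 0)) := by
    ext τ
    constructor
    · rintro ⟨⟨x, hx⟩, ⟨y, hy⟩⟩
      rw [mem_chamber_cons] at hx hy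
      have hx0 : 0 < ℓ 0 x := by simpa using hx.1
      have hy0 : ℓ 0 y < 0 := by simpa [Units.smul_def] using hy.1
      -- the segment from `x` to `y` crosses the hyperplane here
      let z : E := (-ℓ 0 y / (ℓ 0 x - ℓ 0 y)) • x + (ℓ 0 x / (ℓ 0 x - ℓ 0 y)) • y
      have hd : 0 < ℓ 0 x - ℓ 0 y := by linarith
      have hz : z ∈ chamber (Fin.tail ℓ) τ :=
        convex_chamber _ _ hx.2 hy.2 (div_nonneg (by linarith) hd.le) (div_nonneg hx0.le hd.le)
          (by field_simp; ring)
      have hz0 : ℓ 0 z = 0 := by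
        simp only [z, map_add, map_smul, smul_eq_mul]
        field_simp
        ring
      exact ⟨⟨z, hz0⟩, fun i => hz i⟩
    · rintro ⟨⟨x, hx0⟩, hx⟩
      exact ⟨hpush x τ hx0 (fun i => hx i) _, hpush x τ hx0 (fun i => hx i) _⟩
  rw [hsplit, Set.ncard_union_eq hdisj, Set.ncard_image_of_injective _ (Fin.cons_right_injective _),
    Set.ncard_image_of_injective _ (Fin.cons_right_injective _), ← Set.ncard_union_add_ncard_inter,
    hunion, hinter]

/-- General position passes to the restriction to one of the hyperplanes: a relation on `ker (ℓ 0)`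
comes from a relation on the whole space that also involves `ℓ 0`. -/
lemma linearIndepOn_domRestrict_ker (ℓ : Fin (m + 1) → Module.Dual ℝ E) {d : ℕ}
    (h : ∀ s : Finset (Fin (m + 1)), s.card ≤ d + 1 → LinearIndepOn ℝ ℓ (s : Set (Fin (m + 1))))
    (s : Finset (Fin m)) (hs : s.card ≤ d) :
    LinearIndepOn ℝ (fun i : Fin m => (ℓ i.succ).domRestrict (LinearMap.ker (ℓ 0)))
      (s : Set (Fin m)) := by
  rw [linearIndepOn_finset_iff]
  intro g hg i hi
  let f : Module.Dual ℝ E := ∑ j ∈ s, g j • ℓ j.succ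
  have hf : LinearMap.ker (ℓ 0) ≤ LinearMap.ker f := by
    intro x hx
    have := LinearMap.congr_fun hg ⟨x, hx⟩
    simpa [f] using this
  obtain ⟨c, hc⟩ : ∃ c : ℝ, c • ℓ 0 = f := by
    have : f ∈ Submodule.span ℝ (Set.range fun _ : Unit => ℓ 0) :=
      mem_span_of_iInf_ker_le_ker (by simpa using hf)
    simpa [Submodule.mem_span_singleton] using this
  have hins := h (insert 0 (s.map (Fin.succEmb m)))
    ((Finset.card_insert_le _ _).trans (by simpa using hs))
  rw [linearIndepOn_finset_iff] at hins
  have := hins (Fin.cons (-c) g) (by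
    rw [Finset.sum_insert (by simp)]
    simp [hc, f]) i.succ (by simp [hi])
  simpa using this

/-- The number of chambers of an arrangement in general position, meaning that at most `d` of the
functionals are always linearly independent, depends only on `d` and the number of hyperplanes. -/
theorem ncard_signVectors (d m : ℕ) : ∀ {E : Type*} [AddCommGroup E] [Module ℝ E]
    [FiniteDimensional ℝ E], Module.finrank ℝ E = d → ∀ ℓ : Fin m → Module.Dual ℝ E,
    (∀ s : Finset (Fin m), s.card ≤ d → LinearIndepOn ℝ ℓ (s : Set (Fin m))) →
    (signVectors ℓ).ncard = chamberCount d m := by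
  induction m generalizing d with
  | zero =>
    intro E _ _ _ _ ℓ _
    have : signVectors ℓ = {Fin.elim0} := by
      ext σ
      simp only [Set.mem_singleton_iff]
      exact ⟨fun _ => Subsingleton.elim _ _, fun _ => ⟨0, fun i => i.elim0⟩⟩
    simp [this, chamberCount]
  | succ m ih =>
    intro E _ _ _ hE ℓ hℓ
    cases d with
    | zero =>
      have : signVectors ℓ = ∅ := by
        rw [Set.eq_empty_iff_forall_notMem]
        rintro σ ⟨x, hx⟩
        have := Module.finrank_zero_iff.1 hE
        simpa [Subsingleton.elim x 0] using hx 0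
      simp [this, chamberCount]
    | succ d =>
      have h0 : ℓ 0 ≠ 0 := (hℓ {0} (by simp)).ne_zero (by simp)
      rw [ncard_signVectors_succ ℓ h0, chamberCount, ih (d + 1) hE, ih d]
      · have := Module.Dual.finrank_ker_add_one_of_ne_zero h0
        omega
      · exact linearIndepOn_domRestrict_ker ℓ hℓ
      · intro s hs
        have := hℓ (s.map (Fin.succEmb m)) (by simpa using hs)
        rw [linearIndepOn_finset_iff] at this ⊢
        intro g hg i hi
        simpa using this (Fin.cons 0 g) (by simpa [Fin.tail] using hg) i.succ (by simp [hi])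

lemma chamberCount_three (m : ℕ) : chamberCount 3 (m + 1) = m * (m + 1) + 2 := by
  have h1 : ∀ m, chamberCount 1 (m + 1) = 2 := by
    intro m
    induction m with
    | zero => simp [chamberCount]
    | succ m ih => rw [chamberCount, ih]; simp [chamberCount]
  have h2 : ∀ m, chamberCount 2 (m + 1) = 2 * (m + 1) := by
    intro m
    induction m with
    | zero => simp [chamberCount]
    | succ m ih => rw [chamberCount, ih, h1]; ring
  induction m with
  | zero => simp [chamberCount]
  | succ m ih => rw [chamberCount, ih, h2]; ring
end

/-! ### From circles to planes through the origin -/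

/-- The linear functional `(v, z) ↦ ⟪c - O, v⟫ - z`, whose zero set meets the paraboloid in the lift
of the circle with centre `c`. -/
noncomputable def centreFunctional (O c : Plane) : Module.Dual ℝ (Plane × ℝ) :=
  (innerₛₗ ℝ (c - O)).comp (LinearMap.fst ℝ Plane ℝ) - LinearMap.snd ℝ Plane ℝ

lemma centreFunctional_apply (O c : Plane) (x : Plane × ℝ) :
    centreFunctional O c x = inner ℝ (c - O) x.1 - x.2 := rfl

lemma continuous_centreFunctional (O c : Plane) : Continuous (centreFunctional O c) := by
  simp only [funext (centreFunctional_apply O c)]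
  fun_prop

/-- The lift of the plane, with origin `O`, to the paraboloid `2 z = ‖v‖² + 1 - r²`. -/
noncomputable def paraboloidLift (r : ℝ) (O p : Plane) : Plane × ℝ :=
  (p - O, (‖p - O‖ ^ 2 + 1 - r ^ 2) / 2)

lemma continuous_paraboloidLift (r : ℝ) (O : Plane) : Continuous (paraboloidLift r O) := by
  unfold paraboloidLift
  fun_prop

/-- The point of the plane whose lift lies on the ray from the origin through `x`. The factor is the
positive root `t` of `t² ‖v‖² - 2 t z - (r² - 1) = 0`, written so that it makes sense for `v = 0` as
long as `z < 0`. On the half-axis `v = 0, z ≥ 0` there is no such root and the value is junk. -/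
noncomputable def rayProjection (r : ℝ) (O : Plane) (x : Plane × ℝ) : Plane :=
  O + ((r ^ 2 - 1) / (√(x.2 ^ 2 + (r ^ 2 - 1) * ‖x.1‖ ^ 2) - x.2)) • x.1

/-- The complement of the half-axis `v = 0, z ≥ 0`: the union of the open rays that meet the
paraboloid. -/
def offAxis : Set (Plane × ℝ) := {x | x.1 ≠ 0 ∨ x.2 < 0}

lemma dist_sq_eq_of_mem_unit_sphere {O c : Plane} (hc : c ∈ Metric.sphere O 1) (p : Plane) :
    dist p c ^ 2 = ‖p - O‖ ^ 2 - 2 * inner ℝ (c - O) (p - O) + 1 := by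
  have h1 : ‖c - O‖ = 1 := by rwa [← dist_eq_norm]
  rw [dist_eq_norm, show p - c = (p - O) - (c - O) by abel, norm_sub_sq_real, h1,
    real_inner_comm]
  ring

/-- On the lifted plane the functional of `c` is, up to the factor `-1 / 2`, the power of the point
with respect to the circle with centre `c` and radius `r`. -/
lemma centreFunctional_paraboloidLift {r : ℝ} {O c : Plane} (hc : c ∈ Metric.sphere O 1)
    (p : Plane) :
    centreFunctional O c (paraboloidLift r O p) = (r ^ 2 - dist p c ^ 2) / 2 := by
  rw [centreFunctional_apply, dist_sq_eq_of_mem_unit_sphere hc, paraboloidLift]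
  ring

lemma sqrt_sub_pos {r : ℝ} (hr : 1 < r) {x : Plane × ℝ} (hx : x ∈ offAxis) :
    0 < √(x.2 ^ 2 + (r ^ 2 - 1) * ‖x.1‖ ^ 2) - x.2 := by
  have hk : 0 < r ^ 2 - 1 := by nlinarith
  rw [sub_pos]
  rcases hx with h | h
  · apply Real.lt_sqrt_of_sq_lt
    have := norm_pos_iff.2 h
    have : 0 < (r ^ 2 - 1) * ‖x.1‖ ^ 2 := by positivity
    linarith
  · exact h.trans_le (Real.sqrt_nonneg _)

lemma continuousOn_rayProjection {r : ℝ} (hr : 1 < r) (O : Plane) :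
    ContinuousOn (rayProjection r O) offAxis := by
  unfold rayProjection
  refine continuousOn_const.add (ContinuousOn.smul (ContinuousOn.div continuousOn_const
    (by fun_prop) fun x hx => (sqrt_sub_pos hr hx).ne') continuousOn_fst)

lemma paraboloidLift_mem_offAxis {r : ℝ} (hr : 1 < r) (O p : Plane) :
    paraboloidLift r O p ∈ offAxis := by
  by_cases h : p - O = 0
  · right
    simp only [paraboloidLift, h]
    norm_num
    nlinarith
  · exact Or.inl h

lemma rayProjection_paraboloidLift {r : ℝ} (hr : 1 < r) (O p : Plane) :
    rayProjection r O (paraboloidLift r O p) = p := by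
  have hk : 0 < r ^ 2 - 1 := by nlinarith
  have hs : √(((‖p - O‖ ^ 2 + 1 - r ^ 2) / 2) ^ 2 + (r ^ 2 - 1) * ‖p - O‖ ^ 2) =
      (‖p - O‖ ^ 2 + (r ^ 2 - 1)) / 2 := by
    rw [Real.sqrt_eq_iff_mul_self_eq (by positivity) (by positivity)]
    ring
  simp only [rayProjection, paraboloidLift, hs]
  rw [show (‖p - O‖ ^ 2 + (r ^ 2 - 1)) / 2 - (‖p - O‖ ^ 2 + 1 - r ^ 2) / 2 = r ^ 2 - 1 by ring,
    div_self hk.ne']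
  simp

lemma exists_paraboloidLift_rayProjection {r : ℝ} (hr : 1 < r) (O : Plane) {x : Plane × ℝ}
    (hx : x ∈ offAxis) : ∃ t : ℝ, 0 < t ∧ paraboloidLift r O (rayProjection r O x) = t • x := by
  have hk : 0 < r ^ 2 - 1 := by nlinarith
  have hD := sqrt_sub_pos hr hx
  refine ⟨_, div_pos hk hD, Prod.ext (by simp [paraboloidLift, rayProjection]) ?_⟩
  have hsq := Real.sq_sqrt (show 0 ≤ x.2 ^ 2 + (r ^ 2 - 1) * ‖x.1‖ ^ 2 by positivity)
  simp only [paraboloidLift, rayProjection, add_sub_cancel_left, norm_smul, mul_pow,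
    Real.norm_eq_abs, sq_abs, Prod.smul_snd, smul_eq_mul]
  set D := √(x.2 ^ 2 + (r ^ 2 - 1) * ‖x.1‖ ^ 2)
  have hD' := hD.ne'
  field_simp
  linear_combination (1 - r ^ 2) * hsq

/-- The planes are in general position, because at most three distinct points of a circle are
affinely independent. -/
lemma linearIndepOn_centreFunctional {n : ℕ} {O : Plane} {c : Fin n → Plane}
    (hc : ∀ i, c i ∈ Metric.sphere O 1) (hinj : Function.Injective c) (s : Finset (Fin n))
    (hs : s.card ≤ 3) :
    LinearIndepOn ℝ (fun i => centreFunctional O (c i)) (s : Set (Fin n)) := by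
  rw [linearIndepOn_finset_iff]
  intro g hg
  -- evaluating the relation on the two factors of `Plane × ℝ` turns it into an affine relation
  have hsum : ∑ i ∈ s, g i = 0 := by
    simpa [centreFunctional_apply] using LinearMap.congr_fun hg (0, -1)
  have hvec : ∑ i ∈ s, g i • c i = 0 := by
    have h : ∑ i ∈ s, g i • (c i - O) = 0 := by
      refine ext_inner_right ℝ fun v => ?_
      simpa [centreFunctional_apply, sum_inner, real_inner_smul_left] using
        LinearMap.congr_fun hg (v, 0)
    simpa [smul_sub, Finset.sum_sub_distrib, ← Finset.sum_smul, hsum] using h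
  obtain h | h | h | h : s.card = 0 ∨ s.card = 1 ∨ s.card = 2 ∨ s.card = 3 := by omega
  · simp [Finset.card_eq_zero.1 h]
  · obtain ⟨i, rfl⟩ := Finset.card_eq_one.1 h
    simpa using hsum
  · obtain ⟨i, j, hij, rfl⟩ := Finset.card_eq_two.1 h
    rw [Finset.sum_pair hij] at hsum hvec
    have hj : g j = -g i := by linarith
    have : g i • (c i - c j) = 0 := by
      rw [← hvec, hj, smul_sub, neg_smul, sub_eq_add_neg]
    have hi : g i = 0 := (smul_eq_zero.1 this).resolve_right (sub_ne_zero.2 (hinj.ne hij))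
    simp [hj, hi]
  · obtain ⟨i, j, k, hij, hik, hjk, rfl⟩ := Finset.card_eq_three.1 h
    have hcos : EuclideanGeometry.Cospherical (Metric.sphere O 1) := ⟨O, 1, fun p hp => hp⟩
    have haff := affineIndependent_iff.1 (hcos.affineIndependent_of_mem_of_ne (hc i) (hc j) (hc k)
      (hinj.ne hij) (hinj.ne hik) (hinj.ne hjk)) Finset.univ ![g i, g j, g k]
      (by
        rw [Finset.sum_insert (by simp [hij, hik]), Finset.sum_pair hjk] at hsum
        simpa [Fin.sum_univ_three, add_assoc] using hsum)
      (by
        rw [Finset.sum_insert (by simp [hij, hik]), Finset.sum_pair hjk] at hvec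
        simpa [Fin.sum_univ_three, add_assoc] using hvec)
    have h0 := haff 0 (Finset.mem_univ _)
    have h1 := haff 1 (Finset.mem_univ _)
    have h2 := haff 2 (Finset.mem_univ _)
    simp at h0 h1 h2
    simp [h0, h1, h2]

lemma isPreconnected_chamber_inter_offAxis {n : ℕ} (hn : 1 ≤ n) (O : Plane) (c : Fin n → Plane)
    (σ : Fin n → ℤˣ) :
    IsPreconnected (chamber (fun i => centreFunctional O (c i)) σ ∩ offAxis) := by
  by_cases hσ : ∃ j, σ j = 1
  · -- a positive sign keeps the chamber away from the removed half-axis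
    obtain ⟨j, hj⟩ := hσ
    rw [Set.inter_eq_left.2]
    · exact (convex_chamber _ σ).isPreconnected
    · intro x hx
      have hxj := hx j
      simp only [hj, one_smul, centreFunctional_apply] at hxj
      by_cases h : x.1 = 0
      · right
        simpa [h] using hxj
      · exact Or.inl h
  · -- the remaining chamber lies above the graph of the maximum `F` of the functions `⟪c i - O, v⟫`
    have hneg : ∀ i, σ i = -1 := fun i =>
      (Int.units_eq_one_or (σ i)).resolve_left fun h => hσ ⟨i, h⟩
    have hne : (Finset.univ : Finset (Fin n)).Nonempty := ⟨⟨0, hn⟩, Finset.mem_univ _⟩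
    let F : Plane → ℝ := fun v => Finset.univ.sup' hne fun i => inner ℝ (c i - O) v
    have hF : Continuous F := Continuous.finset_sup'_apply hne fun i _ => by fun_prop
    have himage : chamber (fun i => centreFunctional O (c i)) σ ∩ offAxis =
        (fun y : Plane × ℝ => (y.1, F y.1 + y.2)) '' ({0}ᶜ ×ˢ Set.Ioi 0) := by
      ext ⟨v, z⟩
      have hz : (v, z) ∈ chamber (fun i => centreFunctional O (c i)) σ ↔ F v < z := by
        simp [chamber, hneg, Units.smul_def, centreFunctional_apply, F, Finset.sup'_lt_iff]
      rw [Set.mem_inter_iff, hz]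
      constructor
      · rintro ⟨hFz, hv⟩
        refine ⟨(v, z - F v), ⟨?_, sub_pos.2 hFz⟩, by simp⟩
        rintro rfl
        have : F 0 = 0 := by simp [F]
        rcases hv with h | h
        · exact h rfl
        · exact absurd (this ▸ hFz) (not_lt.2 h.le)
      · rintro ⟨⟨w, l⟩, ⟨hw, hl⟩, h⟩
        obtain ⟨rfl, rfl⟩ := Prod.mk.inj h
        exact ⟨lt_add_of_pos_right _ hl, Or.inl hw⟩
    rw [himage]
    have hrank : 1 < Module.rank ℝ Plane := by
      rw [← Module.finrank_eq_rank]
      simp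
    exact ((isConnected_compl_singleton_of_one_lt_rank hrank 0).isPreconnected.prod
      isPreconnected_Ioi).image _ (by fun_prop)

lemma nonempty_chamber_inter_offAxis {n : ℕ} {O : Plane} {c : Fin n → Plane}
    {σ : Fin n → ℤˣ} (h : (chamber (fun i => centreFunctional O (c i)) σ).Nonempty) :
    (chamber (fun i => centreFunctional O (c i)) σ ∩ offAxis).Nonempty := by
  obtain ⟨x, hx⟩ := h
  by_cases hx0 : x.1 = 0
  · have hE := (eventually_add_smul_mem_chamber hx
      ((EuclideanSpace.single 0 1 : Plane), (0 : ℝ))).filter_mono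
      (nhdsWithin_le_nhds (s := Set.Ioi 0))
    obtain ⟨t, ht, ht0⟩ := (hE.and self_mem_nhdsWithin).exists
    have ht0 : (0 : ℝ) < t := ht0
    exact ⟨_, ht, Or.inl (by simp [hx0, ht0.ne'])⟩
  · exact ⟨x, hx, Or.inl hx0⟩

/-- The set of points of the plane with sign vector `σ` is the projection of the chamber of `σ`
along rays. -/
lemma preimage_chamber_eq_image {n : ℕ} {r : ℝ} (hr : 1 < r) (O : Plane) (c : Fin n → Plane)
    (σ : Fin n → ℤˣ) :
    paraboloidLift r O ⁻¹' chamber (fun i => centreFunctional O (c i)) σ =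
      rayProjection r O '' (chamber (fun i => centreFunctional O (c i)) σ ∩ offAxis) := by
  ext p
  constructor
  · intro hp
    exact ⟨_, ⟨hp, paraboloidLift_mem_offAxis hr O p⟩, rayProjection_paraboloidLift hr O p⟩
  · rintro ⟨x, ⟨hx, hx'⟩, rfl⟩ i
    obtain ⟨t, ht, h⟩ := exists_paraboloidLift_rayProjection hr O hx'
    rw [h, map_smul, smul_comm]
    exact mul_pos ht (hx i)

/-- Where none of the continuous functions `f i` vanishes, a preconnected set of points with common
signs is a whole connected component, since the signs are constant on components. -/
lemma connectedComponentIn_eq_of_forall_pos {X ι : Type*} [TopologicalSpace X] {f : ι → X → ℝ}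
    (hf : ∀ i, Continuous (f i)) {σ : ι → ℤˣ} (hσ : IsPreconnected {y | ∀ i, 0 < σ i • f i y})
    {x : X} (hx : ∀ i, 0 < σ i • f i x) :
    connectedComponentIn {y | ∀ i, f i y ≠ 0} x = {y | ∀ i, 0 < σ i • f i y} := by
  have hne : ∀ {i y}, 0 < σ i • f i y → f i y ≠ 0 := fun h h0 => by simp [h0] at h
  have hxU : x ∈ {y | ∀ i, f i y ≠ 0} := fun i => hne (hx i)
  apply Set.Subset.antisymm
  · intro y hy i
    have hcont : Continuous fun y => σ i • f i y := by
      rcases Int.units_eq_one_or (σ i) with h | h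
      · simpa [h] using hf i
      · have hneg : (fun y => σ i • f i y) = fun y => -f i y := by
          funext y
          simp [h, Units.smul_def]
        rw [hneg]
        exact (hf i).neg
    refine isPreconnected_connectedComponentIn.subset_left_of_subset_union
      (isOpen_lt continuous_const hcont) (isOpen_lt hcont (continuous_const (y := (0 : ℝ)))) ?_ ?_
      ⟨x, mem_connectedComponentIn hxU, hx i⟩ hy
    · exact Set.disjoint_left.2 fun z (h1 : 0 < σ i • f i z) (h2 : σ i • f i z < 0) =>
        lt_asymm h1 h2
    · intro z hz
      have hz0 : σ i • f i z ≠ 0 := by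
        have hz' : f i z ≠ 0 := connectedComponentIn_subset _ _ hz i
        rcases Int.units_eq_one_or (σ i) with h | h <;> simpa [h, Units.smul_def] using hz'
      exact hz0.lt_or_gt.symm
  · exact hσ.subset_connectedComponentIn hx fun y hy i => hne (hy i)

lemma exists_pos_units_smul {a : ℝ} (ha : a ≠ 0) : ∃ e : ℤˣ, 0 < e • a := by
  rcases ha.lt_or_gt with h | h
  · exact ⟨-1, by simpa [Units.smul_def] using h⟩
  · exact ⟨1, by simpa using h⟩

lemma eq_of_pos_units_smul {a : ℝ} {e e' : ℤˣ} (h : 0 < e • a) (h' : 0 < e' • a) : e = e' := by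
  rcases Int.units_eq_one_or e with rfl | rfl <;> rcases Int.units_eq_one_or e' with rfl | rfl <;>
    simp [Units.smul_def] at h h' ⊢ <;> linarith

/-- The regions are the sets of points with a given sign vector, for the sign vectors of the
nonempty chambers. -/
theorem planeRegions_eq_image {n : ℕ} (hn : 1 ≤ n) {r : ℝ} (hr : 1 < r) {O : Plane}
    {C : Fin n → EuclideanGeometry.Sphere Plane} (hradius : ∀ i, (C i).radius = r)
    (hcenter : ∀ i, (C i).center ∈ Metric.sphere O 1) :
    planeRegions C =
      (fun σ => paraboloidLift r O ⁻¹' chamber (fun i => centreFunctional O (C i).center) σ) ''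
        signVectors (fun i => centreFunctional O (C i).center) := by
  set ℓ := fun i => centreFunctional O (C i).center with hℓ
  let f : Fin n → Plane → ℝ := fun i p => ℓ i (paraboloidLift r O p)
  have hU : (⋃ i, (C i : Set Plane))ᶜ = {p | ∀ i, f i p ≠ 0} := by
    ext p
    have : ∀ i, f i p = 0 ↔ p ∈ (C i : Set Plane) := by
      intro i
      simp only [f, ℓ, centreFunctional_paraboloidLift (hcenter i), 
        Metric.mem_sphere, hradius, div_eq_zero_iff, sub_eq_zero]
      rw [sq_eq_sq₀ (by linarith) dist_nonneg]
      norm_num [eq_comm]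
    simp [this]
  have hcomp : ∀ p σ, (∀ i, 0 < σ i • f i p) →
      connectedComponentIn (⋃ i, (C i : Set Plane))ᶜ p = paraboloidLift r O ⁻¹' chamber ℓ σ := by
    intro p σ hp
    rw [hU]
    refine connectedComponentIn_eq_of_forall_pos (fun i =>
      (continuous_centreFunctional _ _).comp (continuous_paraboloidLift r O)) ?_ hp
    change IsPreconnected (paraboloidLift r O ⁻¹' chamber ℓ σ)
    rw [preimage_chamber_eq_image hr]
    exact (isPreconnected_chamber_inter_offAxis hn _ _ _).image _
      ((continuousOn_rayProjection hr O).mono Set.inter_subset_right)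
  ext R
  constructor
  · rintro ⟨p, hp, rfl⟩
    rw [hU] at hp
    choose σ hσ using fun i => exists_pos_units_smul (hp i)
    exact ⟨σ, ⟨_, hσ⟩, (hcomp p σ hσ).symm⟩
  · rintro ⟨σ, hσ, rfl⟩
    obtain ⟨p, hp⟩ : (paraboloidLift r O ⁻¹' chamber ℓ σ).Nonempty := by
      rw [preimage_chamber_eq_image hr]
      exact (nonempty_chamber_inter_offAxis hσ).image _
    refine ⟨p, ?_, (hcomp p σ hp).symm⟩
    rw [hU]
    intro i h0
    simpa [f, show ℓ i (paraboloidLift r O p) = 0 from h0] using hp i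

theorem ncard_planeRegions {n : ℕ} (hn : 1 ≤ n) {r : ℝ} (hr : 1 < r) {O : Plane}
    {C : Fin n → EuclideanGeometry.Sphere Plane} (hradius : ∀ i, (C i).radius = r)
    (hcenter : ∀ i, (C i).center ∈ Metric.sphere O 1)
    (hinj : Function.Injective fun i => (C i).center) :
    (planeRegions C).ncard = chamberCount 3 n := by
  rw [planeRegions_eq_image hn hr hradius hcenter, Set.InjOn.ncard_image]
  · exact ncard_signVectors 3 n (by simp) _ (linearIndepOn_centreFunctional hcenter hinj)
  · intro σ hσ τ _ h
    obtain ⟨p, hp⟩ : (paraboloidLift r O ⁻¹'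
        chamber (fun i => centreFunctional O (C i).center) σ).Nonempty := by
      rw [preimage_chamber_eq_image hr]
      exact (nonempty_chamber_inter_offAxis hσ).image _
    have hp' : p ∈ paraboloidLift r O ⁻¹' chamber (fun i => centreFunctional O (C i).center) τ :=
      (Set.ext_iff.1 h p).1 hp
    exact funext fun i => eq_of_pos_units_smul (hp i) (hp' i)

/-! ### General arrangement and the number of regions -/

lemma exists_mem_sphere_inter {r : ℝ} (hr : 1 < r) {O c c' : Plane} (hc : c ∈ Metric.sphere O 1)
    (hc' : c' ∈ Metric.sphere O 1) : (Metric.sphere c r ∩ Metric.sphere c' r).Nonempty := by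
  -- the planes of `c` and `c'` share a line through the origin off the axis; project it
  obtain ⟨v, hv, hv0⟩ : ∃ v : Plane, inner ℝ (c - c') v = 0 ∧ v ≠ 0 := by
    have h : 0 < Module.finrank ℝ (ℝ ∙ (c - c'))ᗮ := by
      have h1 := (ℝ ∙ (c - c')).finrank_add_finrank_orthogonal
      have h2 := finrank_span_le_card (R := ℝ) ({c - c'} : Set Plane)
      simp only [finrank_euclideanSpace, Fintype.card_fin] at h1
      simp only [Set.toFinset_singleton, Finset.card_singleton] at h2
      omega
    have := Module.finrank_pos_iff.1 h
    obtain ⟨⟨v, hv⟩, hv0⟩ := exists_ne (0 : (ℝ ∙ (c - c'))ᗮ)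
    exact ⟨v, Submodule.mem_orthogonal_singleton_iff_inner_right.1 hv, fun h => hv0 (by simp [h])⟩
  let x : Plane × ℝ := (v, inner ℝ (c - O) v)
  have hx : x ∈ offAxis := Or.inl hv0
  obtain ⟨t, -, h⟩ := exists_paraboloidLift_rayProjection hr O hx
  have key : ∀ e ∈ Metric.sphere O 1, centreFunctional O e x = 0 →
      rayProjection r O x ∈ Metric.sphere e r := by
    intro e he h0
    have := centreFunctional_paraboloidLift (r := r) he (rayProjection r O x)
    rw [h, map_smul, h0, smul_zero] at this
    rw [Metric.mem_sphere, ← sq_eq_sq₀ dist_nonneg (by linarith)]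
    linarith
  refine ⟨_, key c hc (by simp [centreFunctional_apply, x]), key c' hc' ?_⟩
  simp only [centreFunctional_apply, x, ← inner_sub_left]
  rw [show c' - O - (c - O) = -(c - c') by abel, inner_neg_left, hv, neg_zero]

/-- The two points of a circle on the line through its centre `c` and another point `c'`, and their
distances from `c'`; `e = 1` gives the far point and `e = -1` the near one. -/
lemma exists_mem_sphere_dist_eq {r : ℝ} (hr : 0 ≤ r) {c c' : Plane} (hne : c ≠ c')
    (e : ℝ) (he : |e| = 1) :
    ∃ p ∈ Metric.sphere c r, dist p c' = |dist c c' + e * r| := by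
  have hd : 0 < dist c c' := dist_pos.2 hne
  refine ⟨c + (e * r / dist c c') • (c - c'), ?_, ?_⟩
  · rw [Metric.mem_sphere, dist_eq_norm, add_sub_cancel_left, norm_smul, ← dist_eq_norm,
      Real.norm_eq_abs, abs_div, abs_mul, he, abs_of_nonneg hr, abs_of_pos hd]
    field_simp
  · rw [dist_eq_norm, show c + (e * r / dist c c') • (c - c') - c' =
      (1 + e * r / dist c c') • (c - c') by rw [add_smul, one_smul]; abel, norm_smul,
      ← dist_eq_norm, Real.norm_eq_abs, ← abs_of_pos hd, ← abs_mul, abs_of_pos hd]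
    congr 1
    field_simp

theorem inGeneralArrangement_of_center_mem_sphere {ι : Type*} {r : ℝ} (hr : 1 < r) {O : Plane}
    {C : ι → EuclideanGeometry.Sphere Plane} (hradius : ∀ i, (C i).radius = r)
    (hcenter : ∀ i, (C i).center ∈ Metric.sphere O 1)
    (hdistinct : ∀ i j, i ≠ j → (C i).center ≠ (C j).center) : InGeneralArrangement C := by
  have hd : ∀ i j, i ≠ j → 0 < dist (C i).center (C j).center ∧
      dist (C i).center (C j).center < 2 * r := by
    intro i j hij
    refine ⟨dist_pos.2 (hdistinct i j hij), ?_⟩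
    have := dist_triangle_right (C i).center (C j).center O
    rw [hcenter i, hcenter j] at this
    linarith
  have hr0 : 0 ≤ r := by linarith
  constructor
  · intro i j _
    simpa only [hradius] using
      exists_mem_sphere_inter hr (hcenter i) (hcenter j)
  · intro i j hij
    obtain ⟨h1, h2⟩ := hd i j hij
    constructor
    · intro h
      have := h.dist_center
      rw [hradius, hradius] at this
      linarith
    · intro h
      have := h.dist_center
      rw [hradius, hradius] at this
      linarith
  · intro i j hij h
    obtain ⟨p, hp, hpd⟩ := exists_mem_sphere_dist_eq hr0 (hdistinct i j hij) 1 (by simp)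
    have := h (show p ∈ (C i : Set Plane) by
      simpa only [hradius] using hp)
    rw [Metric.mem_closedBall, hpd, hradius] at this
    have := (le_abs_self _).trans this
    linarith [(hd i j hij).1]
  · intro i j hij h
    obtain ⟨p, hp, hpd⟩ := exists_mem_sphere_dist_eq hr0 (hdistinct i j hij) (-1) (by simp)
    refine h (show p ∈ (C i : Set Plane) by
      simpa only [hradius] using hp) ?_
    rw [Metric.mem_ball, hpd, hradius, abs_lt]
    constructor <;> linarith [(hd i j hij).1, (hd i j hij).2]
  · intro i j k hij hik hjk
    -- a common point would be the centre of a circle of radius `r ≠ 1` through three points of the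
    -- unit circle
    rw [Set.eq_empty_iff_forall_notMem]
    rintro p ⟨⟨hi, hj⟩, hk⟩
    have hmem : ∀ l, p ∈ (C l : Set Plane) →
        (C l).center ∈ (⟨p, r⟩ : EuclideanGeometry.Sphere Plane) := by
      intro l hl
      rw [EuclideanGeometry.mem_sphere', ← hradius l]
      exact hl
    have hO : ∀ l, (C l).center ∈ (⟨O, 1⟩ : EuclideanGeometry.Sphere Plane) := hcenter
    have hne : (⟨p, r⟩ : EuclideanGeometry.Sphere Plane) ≠ ⟨O, 1⟩ := by
      intro h
      have := congrArg EuclideanGeometry.Sphere.radius h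
      exact hr.ne' this
    rcases EuclideanGeometry.eq_of_mem_sphere_of_mem_sphere_of_finrank_eq_two (by simp) hne
      (hdistinct i j hij) (hmem i hi) (hmem j hj) (hmem k hk) (hO i) (hO j) (hO k) with h | h
    · exact hdistinct i k hik h.symm
    · exact hdistinct j k hjk h.symm

theorem mainTheorem6 (n : ℕ) (hn : 1 ≤ n) (r : ℝ) (hr : 1 < r) (O : Plane)
    (C : Fin n → EuclideanGeometry.Sphere Plane)
    (hradius : ∀ i, (C i).radius = r)
    (hcenter : ∀ i, (C i).center ∈ Metric.sphere O 1)
    (hdistinct : ∀ i j, i ≠ j → (C i).center ≠ (C j).center) :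
    InGeneralArrangement C ∧
      (planeRegions C).Finite ∧ ((planeRegions C).ncard : ℤ) = (n : ℤ) ^ 2 - (n : ℤ) + 2 := by
  have hinj : Function.Injective fun i => (C i).center := fun i j h =>
    by_contra fun hij => hdistinct i j hij h
  refine ⟨inGeneralArrangement_of_center_mem_sphere hr hradius hcenter hdistinct, ?_, ?_⟩
  · rw [planeRegions_eq_image hn hr hradius hcenter]
    exact (Set.toFinite _).image _
  · obtain ⟨m, rfl⟩ := Nat.exists_eq_add_of_le' hn
    rw [ncard_planeRegions hn hr hradius hcenter hinj, chamberCount_three]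
    push_cast
    ring
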